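/- Let $\mathfrak H$ and $\mathfrak H_n$, $n\in\mathbb N$, be separable complex Hilbert spaces, let $J_n:\mathfrak H\to\mathfrak H_n$ be bounded linear operators, and let $A$ and $A_n$ be (possibly unbounded) self-adjoint operators in $\mathfrak H$ and $\mathfrak H_n$ respectively, with spectra $\sigma(\cdot)$, resolvents $R_A(z)=(A-z)^{-1}$, and projection-valued spectral measures $P_A$, $P_{A_n}$. Suppose that $A_n$ converges to $A$ in the generalized norm resolvent sense, that is, $\sup_n\|J_n\|<\infty$, $\|J_n^*J_n-\mathbb I\|\to0$, $\|J_nJ_n^*-\mathbb I\|\to0$, and $$\lim_{n\to\infty}\|J_n^*R_{A_n}(z)J_n-R_A(z)\|=0$$ for one $z\in\mathbb C\setminus\overline{\sigma(A)\cup\bigcup_n\sigma(A_n)}$. Let $\lambda$ be an isolated point of $\sigma(A)$. Then $J_n$ is boundedly invertible for all sufficiently large $n$, and for every $\varepsilon>0$ so small that $[\lambda-\varepsilon,\lambda+\varepsilon]\cap\sigma(A)=\{\lambda\}$, $$\lim_{n\to\infty}J_n^{-1}P_{A_n}\big((\lambda-\varepsilon,\lambda+\varepsilon)\big)J_n=P_A(\{\lambda\})$$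 in operator norm. In particular, for all sufficiently large $n$ the ranges of $J_n^{-1}P_{A_n}((\lambda-\varepsilon,\lambda+\varepsilon))J_n$, of $P_{A_n}((\lambda-\varepsilon,\lambda+\varepsilon))$ and of $P_A(\{\lambda\})$ have the same dimension in $\mathbb N_0\cup\{\infty\}$. -/

import Mathlib

open MeasureTheory Filter Topology

noncomputable section

namespace UnboundedOp

variable {H : Type*} [NormedAddCommGroup H] [InnerProductSpace ℂ H]

/-- `R` is a bounded, everywhere defined, two-sided inverse of `A - z : D(A) → H`. -/
def IsResolventAt (A : H →ₗ.[ℂ] H) (z : ℂ) (R : H →L[ℂ] H) : Prop :=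
  (∀ ψ : A.domain, R (A ψ - z • (ψ : H)) = ψ) ∧
    ∀ φ : H, ∃ h : R φ ∈ A.domain, A ⟨R φ, h⟩ - z • R φ = φ

/-- The resolvent set `ρ(A)`. -/
def resolventSet (A : H →ₗ.[ℂ] H) : Set ℂ :=
  {z | ∃ R : H →L[ℂ] H, IsResolventAt A z R}

/-- The spectrum `σ(A)`, the complement of the resolvent set. -/
def spectrum (A : H →ₗ.[ℂ] H) : Set ℂ :=
  (resolventSet A)ᶜ

open Classical in
/-- The resolvent `R_A(z) = (A - z)⁻¹` for `z ∈ ρ(A)` (and `0` for `z ∈ σ(A)`). -/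
def resolvent (A : H →ₗ.[ℂ] H) (z : ℂ) : H →L[ℂ] H :=
  if h : ∃ R : H →L[ℂ] H, IsResolventAt A z R then h.choose else 0

/-- `μ` is the spectral measure of `A` at the vector `ψ`: the finite Borel measure on the line with
`⟨ψ, R_A(z) ψ⟩ = ∫ (x - z)⁻¹ dμ(x)` for all nonreal `z`. -/
def IsSpectralMeasureAt (A : H →ₗ.[ℂ] H) (ψ : H) (μ : Measure ℝ) : Prop :=
  IsFiniteMeasure μ ∧
    ∀ z : ℂ, z.im ≠ 0 → inner ℂ ψ (resolvent A z ψ) = ∫ x : ℝ, ((x : ℂ) - z)⁻¹ ∂μ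

open Classical in
/-- The spectral measure `μ_ψ` of `A` at `ψ`. For self-adjoint `A` it exists (the function
`z ↦ ⟨ψ, R_A(z) ψ⟩` is a Herglotz function) and is unique (Stieltjes inversion). -/
def spectralMeasureAt (A : H →ₗ.[ℂ] H) (ψ : H) : Measure ℝ :=
  if h : ∃ μ : Measure ℝ, IsSpectralMeasureAt A ψ μ then h.choose else 0

/-- `P` is the spectral projection of `A` for the Borel set `Ω`: the bounded operator with
quadratic form `⟨ψ, P ψ⟩ = μ_ψ(Ω)`. -/
def IsSpectralProjection (A : H →ₗ.[ℂ] H) (Ω : Set ℝ) (P : H →L[ℂ] H) : Prop :=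
  ∀ ψ : H, inner ℂ ψ (P ψ) = (((spectralMeasureAt A ψ).real Ω : ℝ) : ℂ)

open Classical in
/-- The spectral projection `P_A(Ω)`. For self-adjoint `A` and Borel `Ω` it exists, it is unique by
polarization, and `Ω ↦ P_A(Ω)` is the projection-valued measure of `A`. -/
def spectralProjection (A : H →ₗ.[ℂ] H) (Ω : Set ℝ) : H →L[ℂ] H :=
  if h : ∃ P : H →L[ℂ] H, IsSpectralProjection A Ω P then h.choose else 0

/-- The dimension, in `ℕ ∪ {∞}`, of the range of a bounded operator. -/
def dimRange (P : H →L[ℂ] H) : ℕ∞ :=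
  Cardinal.toENat (Module.rank ℂ (LinearMap.range (P : H →ₗ[ℂ] H)))

/-- `A_n` converges to `A` in the generalized norm resolvent sense, with respect to the
identification operators `J_n : H → H_n`. -/
structure GenNormResolventConverges [CompleteSpace H]
    {K : ℕ → Type*} [∀ n, NormedAddCommGroup (K n)] [∀ n, InnerProductSpace ℂ (K n)]
    [∀ n, CompleteSpace (K n)]
    (J : ∀ n, H →L[ℂ] K n) (An : ∀ n, K n →ₗ.[ℂ] K n) (A : H →ₗ.[ℂ] H) : Prop where
  bounded : ∃ C : ℝ, ∀ n, ‖J n‖ ≤ C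
  adjoint_comp : Tendsto
    (fun n => ‖(ContinuousLinearMap.adjoint (J n)).comp (J n) - ContinuousLinearMap.id ℂ H‖)
    atTop (𝓝 0)
  comp_adjoint : Tendsto
    (fun n => ‖(J n).comp (ContinuousLinearMap.adjoint (J n)) - ContinuousLinearMap.id ℂ (K n)‖)
    atTop (𝓝 0)
  resolvent_tendsto : ∃ z : ℂ, z ∉ closure (spectrum A ∪ ⋃ n, spectrum (An n)) ∧
    Tendsto
      (fun n => ‖(ContinuousLinearMap.adjoint (J n)).comp ((resolvent (An n) z).comp (J n))
        - resolvent A z‖)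
      atTop (𝓝 0)

end UnboundedOp

end

/-! Everything is transferred to the bounded normal operators `R = R_A(z)` and `R_n = R_{A_n}(z)`;
they need not be self-adjoint, since `z` is an arbitrary common resolvent point. Under `w ↦ z + w⁻¹`
the nonzero spectrum of `R` becomes `σ(A)`, and a spectral projection of `A` for a set separated
from the rest of `σ(A)` is a function of `R`, continuous on its spectrum
(`IsResolventAt.spectralProjection_eq_cfc`). As spectral measures are specified by their Stieltjes
transforms, this uses a Riesz–Markov measure for `R`, its image under `w ↦ z + w⁻¹`, and uniqueness
in Stieltjes inversion.

To compare operators on different spaces, put `G_n = J_n^* J_n → 1`. For large `n`, `V_n = J_n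
G_n^{-1/2}` is unitary, and `V_n⁻¹ R_n V_n = G_n^{-1/2} (J_n^* R_n J_n) G_n^{-1/2} → R` in norm.
Upper semicontinuity of the spectrum carries the gap around `λ` over to `R_n`, and continuity of the
functional calculus makes the cutoffs converge. Since `J_n = V_n G_n^{1/2}`, conjugation by `J_n`
differs from conjugation by `V_n` only by factors tending to `1`
(`tendsto_inverse_comp_cfc_resolventCutoff`). Finally, idempotents at distance less than `1` have
ranges of equal dimension. -/

namespace UnboundedOp

/-! ### Algebra of resolvents -/

section Resolvent

variable {H : Type*} [NormedAddCommGroup H] [InnerProductSpace ℂ H]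
  {A : H →ₗ.[ℂ] H} {z z' : ℂ} {R R' : H →L[ℂ] H}

/-- First resolvent identity: apply `R` to `(A - z) R' φ = φ - (z - z') R' φ`. -/
theorem IsResolventAt.sub_apply (h : IsResolventAt A z R) (h' : IsResolventAt A z' R') (φ : H) :
    R φ - R' φ = (z - z') • R (R' φ) := by
  obtain ⟨hm, he⟩ := h'.2 φ
  have h1 := h.1 ⟨R' φ, hm⟩
  have h2 : A ⟨R' φ, hm⟩ - z • R' φ = φ - (z - z') • R' φ := by
    rw [sub_smul, ← sub_eq_zero, ← sub_eq_zero_of_eq he]; abel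
  rw [h2, map_sub, map_smul] at h1
  rw [sub_eq_iff_eq_add', ← sub_eq_iff_eq_add]; exact h1

theorem IsResolventAt.sub_eq (h : IsResolventAt A z R) (h' : IsResolventAt A z' R') :
    R - R' = (z - z') • (R * R') := by
  ext φ; exact h.sub_apply h' φ

theorem IsResolventAt.unique (h : IsResolventAt A z R) (h' : IsResolventAt A z R') : R = R' := by
  simpa [sub_eq_zero] using h.sub_eq h'

theorem IsResolventAt.resolvent_eq (h : IsResolventAt A z R) : resolvent A z = R := by
  have hex : ∃ R : H →L[ℂ] H, IsResolventAt A z R := ⟨R, h⟩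
  rw [resolvent, dif_pos hex]
  exact hex.choose_spec.unique h

theorem isResolventAt_resolvent (h : z ∉ spectrum A) : IsResolventAt A z (resolvent A z) := by
  rw [spectrum, Set.notMem_compl_iff] at h
  obtain ⟨R, hR⟩ := h
  rwa [hR.resolvent_eq]

theorem IsResolventAt.commute (h : IsResolventAt A z R) (h' : IsResolventAt A z' R') :
    Commute R R' := by
  by_cases hz : z = z'
  · subst hz; rw [h.unique h']
  · have h1 := h.sub_eq h'
    have h2 := h'.sub_eq h
    have h3 : (z - z') • (R * R') = (z - z') • (R' * R) := by
      rw [← h1, ← neg_sub R' R, h2, ← neg_smul, neg_sub]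
    exact smul_right_injective _ (sub_ne_zero.2 hz) h3

/-- The resolvent at `z'` from the one at `z`, when `1 + (z - z') R_A(z)` is invertible. -/
theorem IsResolventAt.mul_inverse (h : IsResolventAt A z R) {B : H →L[ℂ] H}
    (hB : (1 + (z - z') • R) * B = 1) (hB' : B * (1 + (z - z') • R) = 1) :
    IsResolventAt A z' (R * B) := by
  have hcomm : Commute R B := by
    have h0 : Commute R (1 + (z - z') • R) :=
      (Commute.one_right R).add_right ((Commute.refl R).smul_right _)
    have h1 : (1 + (z - z') • R) * (R * B) = R := by
      rw [← mul_assoc, ← h0.eq, mul_assoc, hB, mul_one]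
    calc R * B = B * ((1 + (z - z') • R) * (R * B)) := by rw [← mul_assoc, hB', one_mul]
      _ = B * R := by rw [h1]
  refine ⟨fun ψ => ?_, fun φ => ?_⟩
  · rw [hcomm.eq]
    have h1 : R (A ψ - z' • (ψ : H)) = (1 + (z - z') • R) (ψ : H) := by
      have : A ψ - z' • (ψ : H) = (A ψ - z • (ψ : H)) + (z - z') • (ψ : H) := by
        rw [sub_smul]; abel
      rw [this, map_add, h.1 ψ, map_smul]; simp
    rw [mul_apply_eq_comp, h1, ← mul_apply_eq_comp, hB']; simp
  · obtain ⟨hm, he⟩ := h.2 (B φ)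
    refine ⟨hm, ?_⟩
    have h1 := congrArg (fun T : H →L[ℂ] H => T φ) hB
    change B φ + (z - z') • R (B φ) = φ at h1
    change A ⟨R (B φ), hm⟩ - z' • R (B φ) = φ
    rw [sub_smul] at h1
    rw [← sub_eq_zero, ← sub_eq_zero_of_eq (he.trans (eq_sub_of_add_eq h1))]
    abel

/-- The spectrum of a resolvent of `A` is the image of the spectrum of `A`. -/
theorem IsResolventAt.mem_spectrum (h : IsResolventAt A z R) {w : ℂ} (hw : w ≠ 0) :
    w ∈ _root_.spectrum ℂ R ↔ z + w⁻¹ ∈ spectrum A := by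
  rw [← not_iff_not, spectrum.notMem_iff, spectrum, Set.notMem_compl_iff]
  have key : algebraMap ℂ (H →L[ℂ] H) w - R = w • (1 + (z - (z + w⁻¹)) • R) := by
    rw [Algebra.algebraMap_eq_smul_one, smul_add, smul_smul]
    simp [hw, sub_eq_add_neg]
  have hu : IsUnit (algebraMap ℂ (H →L[ℂ] H) w - R) ↔ IsUnit (1 + (z - (z + w⁻¹)) • R) := by
    rw [key]
    exact isUnit_smul_iff (Units.mk0 w hw) _
  rw [hu]
  constructor
  · rintro ⟨u, hu⟩
    refine ⟨R * (↑u⁻¹ : H →L[ℂ] H), h.mul_inverse ?_ ?_⟩ <;> rw [← hu] <;> simp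
  · rintro ⟨R', h'⟩
    have h1 := h.sub_eq h'
    have h2 := (h.commute h').eq
    -- With `c` the scalar in front of `R'`, the resolvent identity reads `R - R' = c R R'`, so `1 -
    -- c R'` inverts `1 + c R`.
    refine isUnit_iff_exists.2 ⟨1 - (z - (z + w⁻¹)) • R', ?_, ?_⟩
    · rw [add_mul, one_mul, mul_sub, mul_one, smul_mul_smul_comm, mul_smul, ← h1, smul_sub]; abel
    · rw [sub_mul, one_mul, mul_add, mul_one, smul_mul_smul_comm, mul_smul, ← h2, ← h1, smul_sub]
      abel

end Resolvent

/-! ### Resolvents of self-adjoint operators -/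

section SelfAdjoint

variable {H : Type*} [NormedAddCommGroup H] [InnerProductSpace ℂ H] [CompleteSpace H]
  {A : H →ₗ.[ℂ] H} {z z' : ℂ} {R R' : H →L[ℂ] H}

theorem inner_map_of_isSelfAdjoint (hA : IsSelfAdjoint A) (x y : A.domain) :
    inner ℂ (A x) (y : H) = inner ℂ (x : H) (A y) := by
  have h := LinearPMap.adjoint_isFormalAdjoint hA.dense_domain
  rw [LinearPMap.isSelfAdjoint_def.1 hA] at h
  exact h x y

/-- This is the inclusion `D(A*) ⊆ D(A)`, the part of self-adjointness that goes beyond symmetry. -/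
theorem exists_map_eq_of_isSelfAdjoint (hA : IsSelfAdjoint A) {y w : H}
    (h : ∀ x : A.domain, inner ℂ w (x : H) = inner ℂ y (A x)) :
    ∃ hy : y ∈ A.domain, A ⟨y, hy⟩ = w := by
  have hy := LinearPMap.mem_adjoint_domain_of_exists y ⟨w, h⟩
  have he := LinearPMap.adjoint_apply_eq hA.dense_domain ⟨y, hy⟩ h
  revert hy
  rw [LinearPMap.isSelfAdjoint_def.1 hA]
  exact fun hy he => ⟨hy, he⟩

theorem IsResolventAt.star (hA : IsSelfAdjoint A) (h : IsResolventAt A z R) :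
    IsResolventAt A (star z) (star R) := by
  rw [ContinuousLinearMap.star_eq_adjoint]
  refine ⟨fun ψ => ext_inner_right ℂ fun χ => ?_, fun φ => ?_⟩
  · obtain ⟨hm, he⟩ := h.2 χ
    rw [ContinuousLinearMap.adjoint_inner_left, inner_sub_left, inner_smul_left]
    have h1 := inner_map_of_isSelfAdjoint hA ψ ⟨R χ, hm⟩
    simp only at h1
    conv_rhs => rw [← he, inner_sub_right, inner_smul_right]
    rw [h1]; simp
  · have := exists_map_eq_of_isSelfAdjoint hA (y := R.adjoint φ)
      (w := φ + Star.star z • R.adjoint φ)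
      (fun x => by
        have h1 := h.1 x
        rw [inner_add_left, inner_smul_left, ContinuousLinearMap.adjoint_inner_left,
          ContinuousLinearMap.adjoint_inner_left]
        conv_lhs => enter [1]; rw [← h1]
        rw [map_sub, map_smul, inner_sub_right, inner_smul_right]
        simp)
    obtain ⟨hy, he⟩ := this
    exact ⟨hy, by rw [he]; abel⟩

theorem IsResolventAt.isStarNormal (hA : IsSelfAdjoint A) (h : IsResolventAt A z R) :
    IsStarNormal R :=
  ⟨(h.star hA).commute h⟩

theorem IsResolventAt.sub_star_eq (hA : IsSelfAdjoint A) (h : IsResolventAt A z R) :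
    R - Star.star R = (z - Star.star z) • (R * Star.star R) :=
  h.sub_eq (h.star hA)

/-- Spectral mapping applied to `R - R* = (z - z̄) R R*` gives `w - w̄ = (z - z̄) |w|²` on the
spectrum; dividing by `|w|²` shows that `z + w⁻¹` is real. -/
theorem IsResolventAt.im_eq_zero (hA : IsSelfAdjoint A) (h : IsResolventAt A z R) {w : ℂ}
    (hw : w ∈ _root_.spectrum ℂ R) (hw0 : w ≠ 0) : (z + w⁻¹).im = 0 := by
  have hn := h.isStarNormal hA
  have h1 : cfc (fun x : ℂ => x - Star.star x - (z - Star.star z) * (x * Star.star x)) R = 0 := by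
    rw [cfc_sub .., cfc_sub .., cfc_const_mul .., cfc_mul .., cfc_star_id (R := ℂ) (a := R),
      cfc_id' ℂ R,
      h.sub_star_eq hA, sub_self]
  have h2 := cfc_map_spectrum
    (fun x : ℂ => x - Star.star x - (z - Star.star z) * (x * Star.star x)) R
  rw [h1] at h2
  have h3 : (w - Star.star w - (z - Star.star z) * (w * Star.star w)) ∈
      _root_.spectrum ℂ (0 : H →L[ℂ] H) := h2 ▸ ⟨w, hw, rfl⟩
  have h4 : w - Star.star w - (z - Star.star z) * (w * Star.star w) = 0 := by
    by_contra hne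
    refine h3 ?_
    rw [spectrum.mem_resolventSet_iff, sub_zero]
    exact (isUnit_iff_ne_zero.2 hne).map _
  have hsw : Star.star w ≠ 0 := star_ne_zero.2 hw0
  have h5 : Star.star (z + w⁻¹) = z + w⁻¹ := by
    rw [star_add, star_inv₀]
    field_simp
    linear_combination h4
  exact Complex.conj_eq_iff_im.1 h5

theorem IsResolventAt.notMem_spectrum_of_im_ne_zero (hA : IsSelfAdjoint A)
    (h : IsResolventAt A z R) (hz : z'.im ≠ 0) : z' ∉ spectrum A := by
  by_cases hzz : z' = z
  · subst hzz; exact Set.notMem_compl_iff.2 ⟨R, h⟩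
  · intro hs
    have hne := sub_ne_zero.2 hzz
    have e : z + ((z' - z)⁻¹)⁻¹ = z' := by rw [inv_inv]; ring
    rw [← e, ← h.mem_spectrum (inv_ne_zero hne)] at hs
    exact hz (e ▸ h.im_eq_zero hA hs (inv_ne_zero hne))

/-- The resolvents of a self-adjoint operator as functions of one of them. -/
theorem IsResolventAt.resolvent_eq_cfc (hA : IsSelfAdjoint A) (h : IsResolventAt A z R)
    (hz : z' ∉ spectrum A) :
    (∀ w ∈ _root_.spectrum ℂ R, 1 + (z - z') * w ≠ 0) ∧
      resolvent A z' = cfc (fun w : ℂ => w * (1 + (z - z') * w)⁻¹) R := by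
  have hn := h.isStarNormal hA
  have hne : ∀ w ∈ _root_.spectrum ℂ R, 1 + (z - z') * w ≠ 0 := by
    intro w hw h0
    have hw0 : w ≠ 0 := by rintro rfl; simp at h0
    apply hz
    have : z + w⁻¹ = z' := by field_simp; linear_combination h0
    rw [← this]
    exact (h.mem_spectrum hw0).1 hw
  have hc : ContinuousOn (fun w : ℂ => (1 + (z - z') * w)⁻¹) (_root_.spectrum ℂ R) :=
    ContinuousOn.inv₀ (by fun_prop) hne
  have hd : (1 + (z - z') • R) = cfc (fun w : ℂ => 1 + (z - z') * w) R := by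
    rw [cfc_const_add .., cfc_const_mul .., cfc_id' ℂ R, map_one]
  refine ⟨hne, ?_⟩
  rw [cfc_mul _ _ _ (by fun_prop) hc, cfc_id' ℂ R]
  refine (h.mul_inverse ?_ ?_).resolvent_eq
  · rw [hd, ← cfc_mul _ _ _ (by fun_prop) hc, ← cfc_one ℂ R]
    exact cfc_congr fun w hw => mul_inv_cancel₀ (hne w hw)
  · rw [hd, ← cfc_mul _ _ _ hc (by fun_prop), ← cfc_one ℂ R]
    exact cfc_congr fun w hw => inv_mul_cancel₀ (hne w hw)

end SelfAdjoint

end UnboundedOp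

/-! ### Stieltjes inversion for finite measures on the line -/

section Stieltjes

namespace MeasureTheory

theorem im_inv_ofReal_sub (t x y : ℝ) :
    (((t : ℂ) - (x + y * Complex.I))⁻¹).im = y / ((t - x) ^ 2 + y ^ 2) := by
  rw [Complex.inv_im, Complex.normSq_apply]
  simp
  ring_nf

theorem continuous_poisson {y : ℝ} (hy : 0 < y) :
    Continuous fun q : ℝ × ℝ => y / ((q.2 - q.1) ^ 2 + y ^ 2) :=
  continuous_const.div (by fun_prop) fun q => by positivity

theorem norm_poisson_le {y : ℝ} (hy : 0 < y) (x t : ℝ) :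
    ‖y / ((t - x) ^ 2 + y ^ 2)‖ ≤ y⁻¹ := by
  rw [Real.norm_of_nonneg (by positivity), div_le_iff₀ (by positivity), inv_mul_eq_div,
    le_div_iff₀ hy]
  nlinarith [sq_nonneg (t - x)]

theorem integrable_inv_ofReal_sub (μ : Measure ℝ) [IsFiniteMeasure μ] {z : ℂ} (hz : z.im ≠ 0) :
    Integrable (fun t : ℝ => ((t : ℂ) - z)⁻¹) μ := by
  have hne : ∀ t : ℝ, (t : ℂ) - z ≠ 0 := fun t h => hz (by simpa using congrArg Complex.im h)
  refine Integrable.of_bound (C := |z.im|⁻¹)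
    (Continuous.inv₀ (by fun_prop) hne).aestronglyMeasurable (Eventually.of_forall fun t => ?_)
  rw [norm_inv]
  refine inv_anti₀ (abs_pos.2 hz) ?_
  simpa using Complex.abs_im_le_norm ((t : ℂ) - z)

theorem im_integral_inv_ofReal_sub (μ : Measure ℝ) [IsFiniteMeasure μ] (x : ℝ) {y : ℝ}
    (hy : 0 < y) :
    (∫ t : ℝ, ((t : ℂ) - (x + y * Complex.I))⁻¹ ∂μ).im = ∫ t, y / ((t - x) ^ 2 + y ^ 2) ∂μ := by
  have h := integral_im (𝕜 := ℂ)
    (integrable_inv_ofReal_sub μ (z := x + y * Complex.I) (by simpa using hy.ne'))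
  simp only [RCLike.im_to_complex, im_inv_ofReal_sub] at h
  exact h.symm

/-- The kernel `y² / ((t - a)² + y²)` is bounded by `1` and tends to the indicator of `{a}`. Atoms
must be recovered separately because the inversion formula counts endpoints with weight one half. -/
theorem tendsto_mul_integral_poisson (μ : Measure ℝ) [IsFiniteMeasure μ] (a : ℝ) :
    Tendsto (fun y : ℝ => y * ∫ t, y / ((t - a) ^ 2 + y ^ 2) ∂μ) (𝓝[>] 0) (𝓝 (μ.real {a})) := by
  simp_rw [← integral_const_mul]
  have hlim : μ.real {a} = ∫ t, ({a} : Set ℝ).indicator 1 t ∂μ := by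
    rw [integral_indicator_one (measurableSet_singleton a)]
  rw [hlim]
  refine tendsto_integral_filter_of_dominated_convergence (fun _ => 1) ?_ ?_
    (integrable_const _) (Eventually.of_forall fun t => ?_)
  · filter_upwards [self_mem_nhdsWithin] with y hy
    exact (continuous_const.mul ((continuous_poisson hy).comp
      (by fun_prop : Continuous fun t : ℝ => (a, t)))).aestronglyMeasurable
  · filter_upwards [self_mem_nhdsWithin] with y hy
    refine Eventually.of_forall fun t => ?_
    have hy' : 0 < y := hy
    rw [norm_mul, Real.norm_of_nonneg hy'.le]
    calc y * ‖y / ((t - a) ^ 2 + y ^ 2)‖ ≤ y * y⁻¹ := by gcongr; exact norm_poisson_le hy' _ _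
      _ = 1 := mul_inv_cancel₀ hy'.ne'
  · by_cases hta : t = a
    · subst hta
      refine (tendsto_const_nhds (x := (1 : ℝ))).congr' ?_ |>.trans (by simp)
      filter_upwards [self_mem_nhdsWithin] with y hy
      have hy' : 0 < y := hy
      field_simp
      ring_nf
    · have hc : ContinuousAt (fun y : ℝ => y * (y / ((t - a) ^ 2 + y ^ 2))) 0 := by
        have : (t - a) ^ 2 + (0 : ℝ) ^ 2 ≠ 0 := by
          have := sub_ne_zero.2 hta
          positivity
        fun_prop (disch := assumption)
      have := hc.tendsto.mono_left (nhdsWithin_le_nhds (s := Set.Ioi 0))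
      simpa [hta] using this

theorem integral_poisson_Ioc {a b y : ℝ} (hab : a ≤ b) (hy : 0 < y) (t : ℝ) :
    ∫ x in Set.Ioc a b, y / ((t - x) ^ 2 + y ^ 2) =
      Real.arctan ((b - t) / y) - Real.arctan ((a - t) / y) := by
  rw [← intervalIntegral.integral_of_le hab]
  refine intervalIntegral.integral_eq_sub_of_hasDerivAt
    (f := fun x => Real.arctan ((x - t) / y)) (fun x _ => ?_) ?_
  · have h := (((hasDerivAt_id x).sub_const t).div_const y).arctan
    have he : y / ((t - x) ^ 2 + y ^ 2) = 1 / (1 + ((x - t) / y) ^ 2) * (1 / y) := by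
      field_simp
      ring
    rw [he]
    exact h
  · exact ((continuous_poisson hy).comp
      (by fun_prop : Continuous fun x : ℝ => (x, t))).intervalIntegrable _ _

theorem tendsto_arctan_div (s : ℝ) :
    Tendsto (fun y : ℝ => Real.arctan (s / y)) (𝓝[>] 0) (𝓝 (Real.pi / 2 * Real.sign s)) := by
  rcases lt_trichotomy s 0 with hs | rfl | hs
  · rw [Real.sign_of_neg hs, mul_neg_one]
    exact (tendsto_nhds_of_tendsto_nhdsWithin Real.tendsto_arctan_atBot).comp
      (tendsto_inv_nhdsGT_zero.const_mul_atTop_of_neg hs)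
  · simp
  · rw [Real.sign_of_pos hs, mul_one]
    exact (tendsto_nhds_of_tendsto_nhdsWithin Real.tendsto_arctan_atTop).comp
      (tendsto_inv_nhdsGT_zero.const_mul_atTop hs)

/-- **Stieltjes inversion formula**. -/
theorem tendsto_integral_integral_poisson (μ : Measure ℝ) [IsFiniteMeasure μ] {a b : ℝ}
    (hab : a < b) :
    Tendsto (fun y : ℝ => ∫ x in Set.Ioc a b, ∫ t, y / ((t - x) ^ 2 + y ^ 2) ∂μ) (𝓝[>] 0)
      (𝓝 (Real.pi * μ.real (Set.Ioc a b) +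
        Real.pi / 2 * μ.real {a} - Real.pi / 2 * μ.real {b})) := by
  have h1 : (fun y : ℝ => ∫ t, (Real.arctan ((b - t) / y) - Real.arctan ((a - t) / y)) ∂μ)
      =ᶠ[𝓝[>] 0] fun y : ℝ => ∫ x in Set.Ioc a b, ∫ t, y / ((t - x) ^ 2 + y ^ 2) ∂μ := by
    filter_upwards [self_mem_nhdsWithin] with y hy
    -- Fubini: the kernel is bounded by `y⁻¹` on a product of finite measures, and its integral in
    -- `x` is a difference of arctangents.
    rw [integral_integral_swap]
    · simp_rw [integral_poisson_Ioc hab.le hy]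
    · exact Integrable.of_bound (C := y⁻¹) (continuous_poisson hy).aestronglyMeasurable
        (Eventually.of_forall fun q => norm_poisson_le hy _ _)
  refine Tendsto.congr' h1 ?_
  have hi : ∀ s : Set ℝ, MeasurableSet s → Integrable (s.indicator (1 : ℝ → ℝ)) μ := fun s hs =>
    (integrable_const (1 : ℝ)).indicator hs
  -- The limiting kernel is `π` inside `(a, b)` and `π / 2` at both endpoints; `Ioc` omits `a` and
  -- contains `b`, hence the opposite signs of the corrections.
  have h2 : Real.pi * μ.real (Set.Ioc a b) + Real.pi / 2 * μ.real {a} - Real.pi / 2 * μ.real {b} =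
      ∫ t, (Real.pi / 2 * Real.sign (b - t) - Real.pi / 2 * Real.sign (a - t)) ∂μ := by
    rw [← integral_indicator_one measurableSet_Ioc,
      ← integral_indicator_one (measurableSet_singleton a),
      ← integral_indicator_one (measurableSet_singleton b), ← integral_const_mul,
      ← integral_const_mul, ← integral_const_mul, ← integral_add, ← integral_sub]
    · refine integral_congr_ae (Eventually.of_forall fun t => ?_)
      simp only [Set.indicator_apply, Set.mem_Ioc, Set.mem_singleton_iff, Pi.one_apply]
      rcases lt_trichotomy t a with h | rfl | h
      · rw [Real.sign_of_pos (by linarith), Real.sign_of_pos (by linarith)]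
        simp [h.ne, h.not_gt, (h.trans hab).ne]
      · rw [Real.sign_of_pos (by linarith)]
        simp [hab.ne]
      · rw [Real.sign_of_neg (by linarith : a - t < 0)]
        rcases lt_trichotomy t b with h' | rfl | h'
        · rw [Real.sign_of_pos (by linarith)]
          simp [h, h'.le, h.ne', h'.ne]
        · simp [h, h.ne']
          ring
        · rw [Real.sign_of_neg (by linarith)]
          simp [h.ne', h'.ne', h'.not_ge]
    · exact (((hi _ measurableSet_Ioc).const_mul _).add
        ((hi _ (measurableSet_singleton a)).const_mul _))
    · exact (hi _ (measurableSet_singleton b)).const_mul _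
    · exact (hi _ measurableSet_Ioc).const_mul _
    · exact (hi _ (measurableSet_singleton a)).const_mul _
  rw [h2]
  refine tendsto_integral_filter_of_dominated_convergence (fun _ => Real.pi) ?_ ?_
    (integrable_const _) (Eventually.of_forall fun t =>
      (tendsto_arctan_div _).sub (tendsto_arctan_div _))
  · refine Eventually.of_forall fun y => Continuous.aestronglyMeasurable ?_
    exact (Real.continuous_arctan.comp (by fun_prop)).sub (Real.continuous_arctan.comp (by fun_prop))
  · refine Eventually.of_forall fun y => Eventually.of_forall fun t => ?_
    rw [Real.norm_eq_abs, abs_le]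
    have h1 := Real.arctan_lt_pi_div_two ((b - t) / y)
    have h2 := Real.arctan_lt_pi_div_two ((a - t) / y)
    have h3 := Real.neg_pi_div_two_lt_arctan ((b - t) / y)
    have h4 := Real.neg_pi_div_two_lt_arctan ((a - t) / y)
    constructor <;> linarith

/-- A finite measure on the line is determined by its Stieltjes transform. -/
theorem Measure.ext_of_integral_inv_sub {μ ν : Measure ℝ} [IsFiniteMeasure μ] [IsFiniteMeasure ν]
    (h : ∀ z : ℂ, z.im ≠ 0 → ∫ x : ℝ, ((x : ℂ) - z)⁻¹ ∂μ = ∫ x : ℝ, ((x : ℂ) - z)⁻¹ ∂ν) :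
    μ = ν := by
  have hp : ∀ x y : ℝ, 0 < y →
      ∫ t, y / ((t - x) ^ 2 + y ^ 2) ∂μ = ∫ t, y / ((t - x) ^ 2 + y ^ 2) ∂ν := fun x y hy => by
    rw [← im_integral_inv_ofReal_sub μ x hy, ← im_integral_inv_ofReal_sub ν x hy,
      h _ (by simpa using hy.ne')]
  have hs : ∀ a, μ.real {a} = ν.real {a} := fun a =>
    tendsto_nhds_unique (tendsto_mul_integral_poisson μ a)
      ((tendsto_mul_integral_poisson ν a).congr' (by
        filter_upwards [self_mem_nhdsWithin] with y hy
        rw [hp a y hy]))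
  refine Measure.ext_of_Ioc μ ν fun a b hab => ?_
  have hI := tendsto_nhds_unique (tendsto_integral_integral_poisson μ hab)
    ((tendsto_integral_integral_poisson ν hab).congr' (by
      filter_upwards [self_mem_nhdsWithin] with y hy
      simp_rw [hp _ y hy]))
  rw [hs a, hs b] at hI
  refine (measureReal_eq_measureReal_iff).1 (mul_left_cancel₀ Real.pi_ne_zero ?_)
  linarith

end MeasureTheory

end Stieltjes

/-! ### Spectral measures of bounded normal operators -/

section NormalSpectralMeasure

variable {H : Type*} [NormedAddCommGroup H] [InnerProductSpace ℂ H] [CompleteSpace H]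

theorem ContinuousLinearMap.inner_cfcHom_star_mul_self {R : H →L[ℂ] H} (hR : IsStarNormal R)
    (ψ : H) (f : C(_root_.spectrum ℂ R, ℂ)) :
    inner ℂ ψ (cfcHom hR (star f * f) ψ) = ((‖cfcHom hR f ψ‖ ^ 2 : ℝ) : ℂ) := by
  rw [map_mul, map_star, ContinuousLinearMap.star_eq_adjoint, mul_apply_eq_comp,
    ContinuousLinearMap.adjoint_inner_right, inner_self_eq_norm_sq_to_K]
  simp

/-- The spectral measure of a bounded normal operator at a vector. -/
theorem ContinuousLinearMap.exists_measure_integral_eq_inner_cfcHom {R : H →L[ℂ] H}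
    (hR : IsStarNormal R) (ψ : H) :
    ∃ ν : Measure (_root_.spectrum ℂ R), IsFiniteMeasure ν ∧
      ∀ f : C(_root_.spectrum ℂ R, ℂ), ∫ w, f w ∂ν = inner ℂ ψ (cfcHom hR f ψ) := by
  let X := _root_.spectrum ℂ R
  have : CompactSpace X := isCompact_iff_compactSpace.1 (_root_.spectrum.isCompact R)
  let c : C(X, ℝ) → C(X, ℂ) := fun g => ⟨fun w => (g w : ℂ), by fun_prop⟩
  let L : C(X, ℂ) → ℂ := fun f => inner ℂ ψ (cfcHom hR f ψ)
  have Ladd : ∀ f g, L (f + g) = L f + L g := fun f g => by simp [L]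
  have Lsmul : ∀ (a : ℂ) f, L (a • f) = a * L f := fun a f => by simp [L]
  -- Positivity: with `s = √g`, the value of `L` at `g = s̄ s` is the squared norm of `s(R) ψ`.
  have hc0 : ∀ g : C(X, ℝ), 0 ≤ g → ∃ r : ℝ, 0 ≤ r ∧ L (c g) = r := fun g hg => by
    let s : C(X, ℂ) := ⟨fun w => (Real.sqrt (g w) : ℂ), by fun_prop⟩
    have hs : c g = star s * s := by
      ext w
      change (g w : ℂ) = star (Real.sqrt (g w) : ℂ) * (Real.sqrt (g w) : ℂ)
      rw [Complex.star_def, Complex.conj_ofReal, ← Complex.ofReal_mul,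
        Real.mul_self_sqrt (show 0 ≤ g w from hg w)]
    exact ⟨_, sq_nonneg _, by rw [hs]; exact inner_cfcHom_star_mul_self hR ψ s⟩
  have hcre : ∀ g : C(X, ℝ), L (c g) = ((L (c g)).re : ℂ) := fun g => by
    have hsa : IsSelfAdjoint (cfcHom hR (c g)) := by
      rw [IsSelfAdjoint, ← map_star]
      congr 1
      ext w
      exact Complex.conj_ofReal _
    refine (Complex.conj_eq_iff_re.1 ?_).symm
    change starRingEnd ℂ (inner ℂ ψ (cfcHom hR (c g) ψ)) = inner ℂ ψ (cfcHom hR (c g) ψ)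
    rw [inner_conj_symm, ← ContinuousLinearMap.adjoint_inner_right,
      ← ContinuousLinearMap.star_eq_adjoint, hsa.star_eq]
  -- The spectrum is compact, so all continuous functions have compact support and Riesz–Markov
  -- applies to the real functional; complex functions are recovered from real and imaginary parts.
  let Λ₀ : CompactlySupportedContinuousMap X ℝ →ₗ[ℝ] ℝ :=
    { toFun := fun g => (L (c g.toContinuousMap)).re
      map_add' := fun g g' => by
        rw [← Complex.add_re, ← Ladd]
        congr 2
        ext w
        simp [c]
      map_smul' := fun a g => by
        have : c (a • g).toContinuousMap = (a : ℂ) • c g.toContinuousMap := by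
          ext w
          simp [c]
        rw [this, Lsmul]
        simp }
  let Λ : CompactlySupportedContinuousMap X ℝ →ₚ[ℝ] ℝ := PositiveLinearMap.mk₀ Λ₀ fun g hg => by
    obtain ⟨r, hr, he⟩ := hc0 g.toContinuousMap hg
    change 0 ≤ (L (c g.toContinuousMap)).re
    rw [he]
    exact hr
  have hΛ : ∀ g : C(X, ℝ), ∫ w, g w ∂(RealRMK.rieszMeasure Λ) = (L (c g)).re := fun g =>
    RealRMK.integral_rieszMeasure Λ ⟨g, HasCompactSupport.of_compactSpace _⟩
  refine ⟨RealRMK.rieszMeasure Λ, inferInstance, fun f => ?_⟩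
  let fr : C(X, ℝ) := ⟨fun w => (f w).re, by fun_prop⟩
  let fi : C(X, ℝ) := ⟨fun w => (f w).im, by fun_prop⟩
  have hf : f = c fr + Complex.I • c fi := by
    ext w
    change f w = ((f w).re : ℂ) + Complex.I * ((f w).im : ℂ)
    rw [mul_comm, Complex.re_add_im]
  have hint : Integrable (fun w => f w) (RealRMK.rieszMeasure Λ) :=
    f.continuous.integrable_of_hasCompactSupport (HasCompactSupport.of_compactSpace _)
  have h1 := integral_re_add_im (𝕜 := ℂ) hint
  rw [← h1]
  change ((∫ w, fr w ∂_ : ℝ) : ℂ) + ((∫ w, fi w ∂_ : ℝ) : ℂ) * Complex.I = L f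
  rw [hΛ, hΛ, ← hcre, ← hcre, hf, Ladd, Lsmul, mul_comm]

end NormalSpectralMeasure

/-! ### Spectral measures and projections through a resolvent -/

namespace UnboundedOp

variable {H : Type*} [NormedAddCommGroup H] [InnerProductSpace ℂ H] {A : H →ₗ.[ℂ] H} {z : ℂ}
  {R : H →L[ℂ] H}

/-- The points `w` with `z + w⁻¹` on the line over `Ω`. -/
def resolventPreimage (z : ℂ) (Ω : Set ℝ) : Set ℂ :=
  {w | w ≠ 0 ∧ (z + w⁻¹).re ∈ Ω}

theorem measurableSet_resolventPreimage (z : ℂ) {Ω : Set ℝ} (hΩ : MeasurableSet Ω) :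
    MeasurableSet (resolventPreimage z Ω) :=
  (measurableSet_singleton (0 : ℂ)).compl.inter
    ((by fun_prop : Measurable fun w : ℂ => (z + w⁻¹).re) hΩ)

theorem IsSpectralMeasureAt.unique {ψ : H} {μ ν : Measure ℝ} (hμ : IsSpectralMeasureAt A ψ μ)
    (hν : IsSpectralMeasureAt A ψ ν) : μ = ν := by
  have := hμ.1
  have := hν.1
  exact Measure.ext_of_integral_inv_sub fun z hz => (hμ.2 z hz).symm.trans (hν.2 z hz)

theorem IsSpectralMeasureAt.spectralMeasureAt_eq {ψ : H} {μ : Measure ℝ}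
    (hμ : IsSpectralMeasureAt A ψ μ) : spectralMeasureAt A ψ = μ := by
  have hex : ∃ μ : Measure ℝ, IsSpectralMeasureAt A ψ μ := ⟨μ, hμ⟩
  rw [spectralMeasureAt, dif_pos hex]
  exact hex.choose_spec.unique hμ

theorem IsSpectralProjection.spectralProjection_eq {Ω : Set ℝ} {P : H →L[ℂ] H}
    (hP : IsSpectralProjection A Ω P) : spectralProjection A Ω = P := by
  have hex : ∃ P : H →L[ℂ] H, IsSpectralProjection A Ω P := ⟨P, hP⟩
  rw [spectralProjection, dif_pos hex]
  have h : (hex.choose : H →ₗ[ℂ] H) = P :=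
    (ext_inner_map _ _).1 fun ψ => by
      have h := (hex.choose_spec ψ).trans (hP ψ).symm
      change inner ℂ (hex.choose ψ) ψ = inner ℂ (P ψ) ψ
      rw [← inner_conj_symm, ← inner_conj_symm (P ψ), h]
  exact ContinuousLinearMap.coe_injective h

variable [CompleteSpace H]

/-- The spectral measure of a self-adjoint operator is the image of that of its resolvent. -/
theorem IsResolventAt.isSpectralMeasureAt (hA : IsSelfAdjoint A) (h : IsResolventAt A z R)
    (hR : IsStarNormal R) {ψ : H} {ν : Measure (_root_.spectrum ℂ R)} [IsFiniteMeasure ν]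
    (hν : ∀ f : C(_root_.spectrum ℂ R, ℂ), ∫ w, f w ∂ν = inner ℂ ψ (cfcHom hR f ψ)) :
    IsSpectralMeasureAt A ψ
      ((ν.restrict {w : _root_.spectrum ℂ R | (w : ℂ) ≠ 0}).map
        fun w : _root_.spectrum ℂ R => (z + (w : ℂ)⁻¹).re) := by
  refine ⟨inferInstance, fun z' hz' => ?_⟩
  obtain ⟨hne, hres⟩ := h.resolvent_eq_cfc hA (h.notMem_spectrum_of_im_ne_zero hA hz')
  have hc : ContinuousOn (fun w : ℂ => w * (1 + (z - z') * w)⁻¹) (_root_.spectrum ℂ R) :=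
    continuousOn_id.mul (ContinuousOn.inv₀ (by fun_prop) hne)
  have hne' : ∀ x : ℝ, (x : ℂ) - z' ≠ 0 := fun x h => hz' (by simpa using congrArg Complex.im h)
  have hcont : Continuous fun x : ℝ => ((x : ℂ) - z')⁻¹ := Continuous.inv₀ (by fun_prop) hne'
  rw [hres, cfc_apply _ R hR hc, ← hν, integral_map (by fun_prop)
    hcont.aestronglyMeasurable]
  -- The point `w = 0` corresponds to infinity for `A`. The integrand vanishes there, so that point
  -- can be dropped without knowing whether `ν` charges it.
  rw [← setIntegral_eq_integral_of_forall_compl_eq_zero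
    (s := {w : _root_.spectrum ℂ R | (w : ℂ) ≠ 0})
    (fun w hw => by
      have hw' : (w : ℂ) = 0 := not_not.1 hw
      change (w : ℂ) * _ = 0
      rw [hw', zero_mul])]
  refine setIntegral_congr_fun
    (measurable_subtype_coe (measurableSet_singleton (0 : ℂ)).compl) fun w hw => ?_
  have hw0 : (w : ℂ) ≠ 0 := hw
  -- Taking the real part loses nothing, because `z + w⁻¹` is real on the nonzero spectrum.
  have hre : (((z + (w : ℂ)⁻¹).re : ℝ) : ℂ) = z + (w : ℂ)⁻¹ := by
    apply Complex.ext <;> simp [-Complex.inv_im, h.im_eq_zero hA w.2 hw0]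
  change (w : ℂ) * (1 + (z - z') * w)⁻¹ = ((((z + (w : ℂ)⁻¹).re : ℝ) : ℂ) - z')⁻¹
  rw [hre]
  have h1 := hne w w.2
  have h2 : z + (w : ℂ)⁻¹ - z' = (1 + (z - z') * w) * (w : ℂ)⁻¹ := by field_simp; ring
  rw [h2, mul_inv, inv_inv, mul_comm]

/-- Spectral projections as functions of a resolvent. -/
theorem IsResolventAt.spectralProjection_eq_cfc (hA : IsSelfAdjoint A) (h : IsResolventAt A z R)
    {Ω : Set ℝ} (hΩ : MeasurableSet Ω)
    (hc : ContinuousOn ((resolventPreimage z Ω).indicator (1 : ℂ → ℂ)) (_root_.spectrum ℂ R)) :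
    spectralProjection A Ω = cfc ((resolventPreimage z Ω).indicator (1 : ℂ → ℂ)) R := by
  have hR := h.isStarNormal hA
  refine IsSpectralProjection.spectralProjection_eq fun ψ => ?_
  obtain ⟨ν, hfin, hν⟩ := ContinuousLinearMap.exists_measure_integral_eq_inner_cfcHom hR ψ
  rw [(h.isSpectralMeasureAt hA hR hν).spectralMeasureAt_eq, cfc_apply _ R hR hc, ← hν,
    map_measureReal_apply (by fun_prop) hΩ, measureReal_restrict_apply
      ((by fun_prop : Measurable fun w : _root_.spectrum ℂ R => (z + (w : ℂ)⁻¹).re) hΩ)]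
  have hm : MeasurableSet
      ((Subtype.val : _root_.spectrum ℂ R → ℂ) ⁻¹' resolventPreimage z Ω) :=
    measurable_subtype_coe (measurableSet_resolventPreimage z hΩ)
  have h1 : ∫ w : _root_.spectrum ℂ R, (((Subtype.val : _root_.spectrum ℂ R → ℂ) ⁻¹'
      resolventPreimage z Ω).indicator (fun _ => (1 : ℂ)) w) ∂ν = _ := integral_indicator_const 1 hm
  rw [Complex.real_smul, mul_one] at h1
  refine Eq.trans ?_ (h1.trans ?_)
  · rfl
  · congr 2
    ext w
    exact and_comm

end UnboundedOp

/-! ### The spectral cutoff and its continuity -/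

section Cutoff

/-- The indicator of the points `w` with `|z + w⁻¹ - l| < ε`. -/
noncomputable def resolventCutoff (z l : ℂ) (ε : ℝ) : ℂ → ℂ :=
  {w : ℂ | ‖1 + (z - l) * w‖ < ε * ‖w‖}.indicator 1

/-- The points `w` with `ε / 2 ≤ |z + w⁻¹ - l| ≤ ε`. -/
def resolventAnnulus (z l : ℂ) (ε : ℝ) : Set ℂ :=
  {w | ε / 2 * ‖w‖ ≤ ‖1 + (z - l) * w‖} ∩ {w | ‖1 + (z - l) * w‖ ≤ ε * ‖w‖}

theorem isClosed_resolventAnnulus (z l : ℂ) (ε : ℝ) : IsClosed (resolventAnnulus z l ε) :=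
  (isClosed_le (by fun_prop) (by fun_prop)).inter (isClosed_le (by fun_prop) (by fun_prop))

/-- The cutoff is constantly `1` on the first closed set and `0` on the second. With denominators
cleared, `w = 0` needs no exception: it lies in the second set, as it should when `0` is in the
spectrum of a resolvent. -/
theorem continuousOn_resolventCutoff (z l : ℂ) {ε : ℝ} (hε : 0 < ε) :
    ContinuousOn (resolventCutoff z l ε)
      ({w | ‖1 + (z - l) * w‖ ≤ ε / 2 * ‖w‖} ∪ {w | ε * ‖w‖ ≤ ‖1 + (z - l) * w‖}) := by
  refine ContinuousOn.union_of_isClosed ?_ ?_ (isClosed_le (by fun_prop) (by fun_prop))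
    (isClosed_le (by fun_prop) (by fun_prop))
  · refine continuousOn_const (c := (1 : ℂ)).congr fun w hw => ?_
    have hw' : ‖1 + (z - l) * w‖ ≤ ε / 2 * ‖w‖ := hw
    have hw0 : w ≠ 0 := by
      rintro rfl
      norm_num at hw'
    have : 0 < ‖w‖ := norm_pos_iff.2 hw0
    have hlt : ‖1 + (z - l) * w‖ < ε * ‖w‖ := by nlinarith
    exact if_pos hlt
  · refine continuousOn_const (c := (0 : ℂ)).congr fun w hw => ?_
    have hw' : ε * ‖w‖ ≤ ‖1 + (z - l) * w‖ := hw
    exact if_neg (not_lt.2 hw')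

theorem compl_resolventAnnulus_subset (z l : ℂ) (ε : ℝ) : (resolventAnnulus z l ε)ᶜ ⊆
    {w | ‖1 + (z - l) * w‖ ≤ ε / 2 * ‖w‖} ∪ {w | ε * ‖w‖ ≤ ‖1 + (z - l) * w‖} := by
  intro w hw
  by_contra h
  rw [Set.mem_union, not_or] at h
  have h1 : ¬ ‖1 + (z - l) * w‖ ≤ ε / 2 * ‖w‖ := h.1
  have h2 : ¬ ε * ‖w‖ ≤ ‖1 + (z - l) * w‖ := h.2
  exact hw ⟨(not_le.1 h1).le, (not_le.1 h2).le⟩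

theorem eventually_spectrum_subset {𝕜 A : Type*} [NormedField 𝕜] [ProperSpace 𝕜] [NormedRing A]
    [NormedAlgebra 𝕜 A] [CompleteSpace A] {ι : Type*} {p : Filter ι} {S : ι → A} {S₀ : A}
    (hS : Tendsto S p (𝓝 S₀)) {U : Set 𝕜} (hU : IsOpen U) (h : spectrum 𝕜 S₀ ⊆ U) :
    ∀ᶠ i in p, spectrum 𝕜 (S i) ⊆ U := by
  have h1 := upperHemicontinuous_iff_forall_isOpen.1 (upperHemicontinuous_spectrum 𝕜 A)
  exact hS.eventually (h1 S₀ U hU h)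

theorem tendsto_cfc_resolventCutoff {A : Type*} [CStarAlgebra A] {ι : Type*} {p : Filter ι}
    {S : ι → A} {S₀ : A} (hS : Tendsto S p (𝓝 S₀)) (hn : ∀ᶠ i in p, IsStarNormal (S i))
    (hn₀ : IsStarNormal S₀) {z l : ℂ} {ε : ℝ} (hε : 0 < ε)
    (hgap : spectrum ℂ S₀ ⊆ (resolventAnnulus z l ε)ᶜ) :
    Tendsto (fun i => cfc (resolventCutoff z l ε) (S i)) p
      (𝓝 (cfc (resolventCutoff z l ε) S₀)) := by
  -- Continuity of the functional calculus requires one compact set containing all the spectra on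
  -- which the cutoff is continuous; the ball provides boundedness, the annulus the room for
  -- closedness.
  obtain ⟨r, hr⟩ := (spectrum.isCompact (𝕜 := ℂ) S₀).isBounded.subset_ball 0
  have hs : Metric.ball 0 r ∩ (resolventAnnulus z l ε)ᶜ ⊆ Metric.closedBall 0 r ∩
      ({w | ‖1 + (z - l) * w‖ ≤ ε / 2 * ‖w‖} ∪ {w | ε * ‖w‖ ≤ ‖1 + (z - l) * w‖}) :=
    Set.inter_subset_inter Metric.ball_subset_closedBall (compl_resolventAnnulus_subset z l ε)
  refine Filter.Tendsto.cfc ((isCompact_closedBall 0 r).inter_right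
    ((isClosed_le (by fun_prop) (by fun_prop)).union (isClosed_le (by fun_prop) (by fun_prop))))
    _ hS ?_ hn ((Set.subset_inter hr hgap).trans hs) hn₀
    ((continuousOn_resolventCutoff z l hε).mono Set.inter_subset_right)
  filter_upwards [eventually_spectrum_subset hS
    (Metric.isOpen_ball.inter (isClosed_resolventAnnulus z l ε).isOpen_compl)
    (Set.subset_inter hr hgap)] with i hi using hi.trans hs

end Cutoff

/-! ### Invertibility and polar decomposition of the identification operators -/

section Polar

namespace ContinuousLinearMap

variable {H K : Type*} [NormedAddCommGroup H] [InnerProductSpace ℂ H] [CompleteSpace H]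
  [NormedAddCommGroup K] [InnerProductSpace ℂ K] [CompleteSpace K]

theorem isInvertible_of_norm_adjoint_comp_sub_lt {J : H →L[ℂ] K}
    (h1 : ‖(adjoint J).comp J - ContinuousLinearMap.id ℂ H‖ < 1)
    (h2 : ‖J.comp (adjoint J) - ContinuousLinearMap.id ℂ K‖ < 1) : J.IsInvertible := by
  rw [← neg_sub, norm_neg] at h1 h2
  have hu1 : IsUnit ((adjoint J).comp J) := by
    have := isUnit_one_sub_of_norm_lt_one (x := (1 : H →L[ℂ] H) - (adjoint J).comp J) h1
    rwa [sub_sub_cancel] at this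
  have hu2 : IsUnit (J.comp (adjoint J)) := by
    have := isUnit_one_sub_of_norm_lt_one (x := (1 : K →L[ℂ] K) - J.comp (adjoint J)) h2
    rwa [sub_sub_cancel] at this
  -- By Neumann series `J*J` and `JJ*` are invertible; the first yields a left inverse of `J`, the
  -- second a right inverse, and these coincide.
  obtain ⟨B, -, hB⟩ := isUnit_iff_exists.1 hu1
  obtain ⟨C, hC, -⟩ := isUnit_iff_exists.1 hu2
  have hl : (B ∘L adjoint J) ∘L J = ContinuousLinearMap.id ℂ H := hB
  have hr : J ∘L (adjoint J ∘L C) = ContinuousLinearMap.id ℂ K := hC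
  have he : B ∘L adjoint J = adjoint J ∘L C := by
    calc B ∘L adjoint J = (B ∘L adjoint J) ∘L (J ∘L (adjoint J ∘L C)) := by
          rw [hr, ContinuousLinearMap.comp_id]
      _ = ((B ∘L adjoint J) ∘L J) ∘L (adjoint J ∘L C) := rfl
      _ = adjoint J ∘L C := by rw [hl, ContinuousLinearMap.id_comp]
  exact IsInvertible.of_inverse (g := B ∘L adjoint J) (by rw [he]; exact hr) hl

/-- Conjugation by the unitary part of the polar decomposition of an invertible operator. -/
theorem exists_starAlgEquiv_of_isInvertible {J : H →L[ℂ] K} (hJ : J.IsInvertible)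
    {D E : H →L[ℂ] H} (hE : IsSelfAdjoint E) (hED : E * D = 1)
    (hEJ : E * ((adjoint J).comp J) * E = 1) :
    ∃ φ : (K →L[ℂ] K) ≃⋆ₐ[ℂ] (H →L[ℂ] H), Continuous φ ∧ ∀ T : K →L[ℂ] K,
      φ T = E * ((adjoint J).comp (T.comp J)) * E ∧
        J.inverse.comp (T.comp J) = E * φ T * D := by
  have hJE : ∀ x, E (adjoint J (J (E x))) = x := fun x => congrArg (fun B : H →L[ℂ] H => B x) hEJ
  have hDx : ∀ x, E (D x) = x := fun x => congrArg (fun B : H →L[ℂ] H => B x) hED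
  have hJi : ∀ x, J.inverse (J x) = x := fun x =>
    congrArg (fun B : H →L[ℂ] H => B x) hJ.inverse_comp_self
  have hJi' : ∀ y, J (J.inverse y) = y := fun y =>
    congrArg (fun B : K →L[ℂ] K => B y) hJ.self_comp_inverse
  have hEs : ∀ x y, inner ℂ (E x) y = inner ℂ x (E y) := fun x y => by
    rw [← adjoint_inner_right, ← star_eq_adjoint, hE.star_eq]
  -- `V = J E` is isometric since `E J*J E = 1`, and it maps `D J⁻¹ y` to `y` since `E D = 1`.
  let V₀ : H →ₗᵢ[ℂ] K := ⟨(J.comp E : H →L[ℂ] K), fun x => by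
    change ‖J (E x)‖ = ‖x‖
    have h : inner ℂ (J (E x)) (J (E x)) = inner ℂ x x := by
      rw [← adjoint_inner_right, hEs, hJE]
    rw [inner_self_eq_norm_sq_to_K, inner_self_eq_norm_sq_to_K] at h
    have h' : ‖J (E x)‖ ^ 2 = ‖x‖ ^ 2 := by exact_mod_cast h
    exact (pow_left_inj₀ (norm_nonneg _) (norm_nonneg _) two_ne_zero).1 h'⟩
  let V : H ≃ₗᵢ[ℂ] K := LinearIsometryEquiv.ofSurjective V₀ fun y =>
    ⟨D (J.inverse y), by change J (E (D _)) = y; rw [hDx, hJi']⟩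
  have hV : ∀ x, V x = J (E x) := fun x => rfl
  have hVs : ∀ y, V.symm y = E (adjoint J y) := fun y => by
    obtain ⟨x, rfl⟩ := V.surjective y
    rw [V.symm_apply_apply, hV, hJE]
  have hVi : ∀ y, J.inverse y = E (V.symm y) := fun y => by
    obtain ⟨x, rfl⟩ := V.surjective y
    rw [V.symm_apply_apply, hV, hJi]
  refine ⟨V.symm.conjStarAlgEquiv, ?_, fun T => ⟨?_, ?_⟩⟩
  · exact (NonUnitalStarAlgHom.isometry V.symm.conjStarAlgEquiv
      V.symm.conjStarAlgEquiv.injective).continuous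
  · ext x
    change V.symm (T (V x)) = E (adjoint J (T (J (E x))))
    rw [hVs, hV]
  · ext x
    change J.inverse (T (J x)) = E (V.symm (T (V (D x))))
    rw [hVi, hV, hDx]

/-- The interval is a convenient compact neighbourhood of `1` away from `0`, so both `√x` and `1 /
√x` are continuous on it. -/
theorem eventually_spectrum_real_subset {ι : Type*} {p : Filter ι} {G : ι → H →L[ℂ] H}
    (hG : Tendsto G p (𝓝 1)) :
    ∀ᶠ i in p, spectrum ℝ (G i) ⊆ Set.Icc (1 / 2) (3 / 2) := by
  have h1 : spectrum ℝ (1 : H →L[ℂ] H) ⊆ Set.Ioo (1 / 2) (3 / 2) := by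
    have := CFC.spectrum_algebraMap_subset (A := H →L[ℂ] H) (p := IsSelfAdjoint) (1 : ℝ)
    rw [map_one] at this
    exact this.trans (by norm_num)
  exact (eventually_spectrum_subset hG isOpen_Ioo h1).mono fun i hi =>
    hi.trans Set.Ioo_subset_Icc_self

theorem tendsto_cfc_of_tendsto_one {ι : Type*} {p : Filter ι} {G : ι → H →L[ℂ] H}
    (hG : Tendsto G p (𝓝 1)) (hsa : ∀ i, IsSelfAdjoint (G i)) {f : ℝ → ℝ}
    (hf : ContinuousOn f (Set.Icc (1 / 2) (3 / 2))) (hf1 : f 1 = 1) :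
    Tendsto (fun i => cfc f (G i)) p (𝓝 1) := by
  -- The constant sequence `1` supplies the same bound for the spectrum of the limit.
  have h1 := (eventually_spectrum_real_subset
    (tendsto_const_nhds (x := (1 : H →L[ℂ] H)) (f := (atTop : Filter ℕ)))).exists
  have := Filter.Tendsto.cfc isCompact_Icc f hG (eventually_spectrum_real_subset hG)
    (Eventually.of_forall hsa) h1.choose_spec (IsSelfAdjoint.one _) hf
  rwa [cfc_apply_one, hf1, map_one] at this

end ContinuousLinearMap

end Polar

/-! ### Dimensions of ranges -/

namespace UnboundedOp

section Rank

variable {H K : Type*} [NormedAddCommGroup H] [InnerProductSpace ℂ H]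
  [NormedAddCommGroup K] [InnerProductSpace ℂ K]

/-- `P` is injective on the range of `Q`: if `Q y = y` and `P y = 0`, then `‖y‖ = ‖(P - Q) y‖ ≤ ‖P -
Q‖ ‖y‖`, which forces `y = 0`. -/
theorem rank_range_le_of_norm_sub_lt_one {P Q : H →L[ℂ] H} (hQ : IsIdempotentElem Q)
    (h : ‖P - Q‖ < 1) :
    Module.rank ℂ (LinearMap.range (Q : H →ₗ[ℂ] H)) ≤
      Module.rank ℂ (LinearMap.range (P : H →ₗ[ℂ] H)) := by
  refine LinearMap.rank_le_of_injective
    ((P : H →ₗ[ℂ] H).rangeRestrict.comp (LinearMap.range (Q : H →ₗ[ℂ] H)).subtype)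
    ((injective_iff_map_eq_zero _).2 ?_)
  rintro ⟨_, x, rfl⟩ hx
  have hP : P (Q x) = 0 := congrArg Subtype.val hx
  have hQQ : Q (Q x) = Q x := congrArg (fun T : H →L[ℂ] H => T x) hQ
  have h1 : ‖Q x‖ ≤ ‖P - Q‖ * ‖Q x‖ := by
    have := (P - Q).le_opNorm (Q x)
    rwa [sub_apply, hP, hQQ, zero_sub, norm_neg] at this
  have h2 : ‖Q x‖ = 0 := by nlinarith [norm_nonneg (Q x)]
  exact Subtype.ext (norm_eq_zero.1 h2)

theorem dimRange_eq_of_norm_sub_lt_one {P Q : H →L[ℂ] H} (hP : IsIdempotentElem P)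
    (hQ : IsIdempotentElem Q) (h : ‖P - Q‖ < 1) : dimRange P = dimRange Q :=
  congrArg Cardinal.toENat ((rank_range_le_of_norm_sub_lt_one hP (norm_sub_rev P Q ▸ h)).antisymm
    (rank_range_le_of_norm_sub_lt_one hQ h))

theorem dimRange_inverse_comp {J : H →L[ℂ] K} (hJ : J.IsInvertible) (P : K →L[ℂ] K) :
    dimRange (J.inverse.comp (P.comp J)) = dimRange P := by
  obtain ⟨e, rfl⟩ := hJ
  have hr : LinearMap.range
      (((e : H →L[ℂ] K).inverse.comp (P.comp (e : H →L[ℂ] K)) : H →L[ℂ] H) : H →ₗ[ℂ] H) =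
      (LinearMap.range (P : K →ₗ[ℂ] K)).map (e.symm.toLinearEquiv : K →ₗ[ℂ] H) := by
    rw [ContinuousLinearMap.inverse_equiv]
    ext x
    constructor
    · rintro ⟨y, rfl⟩
      exact ⟨P (e y), ⟨e y, rfl⟩, rfl⟩
    · rintro ⟨_, ⟨y, rfl⟩, rfl⟩
      exact ⟨e.symm y, congrArg (fun t => e.symm (P t)) (e.apply_symm_apply y)⟩
  -- `H` and `K` may live in different universes, so the ranks are compared after lifting.
  have h := (e.symm.toLinearEquiv.submoduleMap (LinearMap.range (P : K →ₗ[ℂ] K))).lift_rank_eq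
  rw [dimRange, dimRange, hr, ← Cardinal.toENat_lift, ← h, Cardinal.toENat_lift]

end Rank

end UnboundedOp

/-! ### The spectral gap seen by the resolvent -/

namespace UnboundedOp

section Gap

variable {H : Type*} [NormedAddCommGroup H] [InnerProductSpace ℂ H] [CompleteSpace H]
  {A : H →ₗ.[ℂ] H} {z : ℂ} {R : H →L[ℂ] H}

theorem norm_one_add_sub_mul (z l : ℂ) {w : ℂ} (hw : w ≠ 0) :
    ‖1 + (z - l) * w‖ = ‖z + w⁻¹ - l‖ * ‖w‖ := by
  rw [← norm_mul]
  congr 1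
  field_simp
  ring

theorem IsResolventAt.exists_ofReal_mem_spectrum (hA : IsSelfAdjoint A) (h : IsResolventAt A z R)
    {w : ℂ} (hw : w ∈ _root_.spectrum ℂ R) (hw0 : w ≠ 0) :
    ∃ x : ℝ, (x : ℂ) ∈ spectrum A ∧ z + w⁻¹ = x := by
  have hx : z + w⁻¹ = ((z + w⁻¹).re : ℂ) :=
    Complex.ext rfl (by rw [h.im_eq_zero hA hw hw0, Complex.ofReal_im])
  exact ⟨_, hx ▸ (h.mem_spectrum hw0).1 hw, hx⟩

/-- A point of the annulus would give `x ∈ σ(A)` with `ε / 2 ≤ |x - l| ≤ ε`, while the gap leaves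
only `x = l`. -/
theorem IsResolventAt.spectrum_subset_compl_resolventAnnulus (hA : IsSelfAdjoint A)
    (h : IsResolventAt A z R) {l ε : ℝ} (hε : 0 < ε)
    (hgap : {x : ℝ | (x : ℂ) ∈ spectrum A} ∩ Set.Icc (l - ε) (l + ε) = {l}) :
    _root_.spectrum ℂ R ⊆ (resolventAnnulus z l ε)ᶜ := by
  rintro w hw ⟨h1, h2⟩
  change ε / 2 * ‖w‖ ≤ ‖1 + (z - l) * w‖ at h1
  change ‖1 + (z - l) * w‖ ≤ ε * ‖w‖ at h2
  have hw0 : w ≠ 0 := by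
    rintro rfl
    norm_num at h2
  obtain ⟨x, hx, hxw⟩ := h.exists_ofReal_mem_spectrum hA hw hw0
  have hn : 0 < ‖w‖ := norm_pos_iff.2 hw0
  rw [norm_one_add_sub_mul z l hw0, hxw, ← Complex.ofReal_sub, Complex.norm_real,
    Real.norm_eq_abs] at h1 h2
  have h3 := le_of_mul_le_mul_right h1 hn
  have h4 := abs_le.1 (le_of_mul_le_mul_right h2 hn)
  have : x ∈ ({l} : Set ℝ) := hgap ▸ ⟨hx, by constructor <;> linarith⟩
  rw [Set.mem_singleton_iff.1 this, sub_self, abs_zero] at h3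
  linarith

theorem IsResolventAt.isIdempotentElem_cfc (hA : IsSelfAdjoint A) (h : IsResolventAt A z R)
    {l ε : ℝ} (hε : 0 < ε) (hgap : _root_.spectrum ℂ R ⊆ (resolventAnnulus z l ε)ᶜ) :
    IsIdempotentElem (cfc (resolventCutoff z l ε) R) := by
  have hn := h.isStarNormal hA
  have hc := (continuousOn_resolventCutoff z l hε).mono
    (hgap.trans (compl_resolventAnnulus_subset z l ε))
  rw [IsIdempotentElem, ← cfc_mul _ _ R hc hc]
  congr 1
  ext w
  by_cases hw : w ∈ {w : ℂ | ‖1 + (z - l) * w‖ < ε * ‖w‖} <;> simp [resolventCutoff, hw]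

/-- Only the trace of `Ω` on the spectrum matters. This flexibility covers both `{l}` for `A` and
the open interval for `A_n` with a single cutoff. -/
theorem IsResolventAt.spectralProjection_eq_cfc_resolventCutoff (hA : IsSelfAdjoint A)
    (h : IsResolventAt A z R) {l ε : ℝ} (hε : 0 < ε)
    (hgap : _root_.spectrum ℂ R ⊆ (resolventAnnulus z l ε)ᶜ) {Ω : Set ℝ} (hΩ : MeasurableSet Ω)
    (hΩε : ∀ x : ℝ, (x : ℂ) ∈ spectrum A → (x ∈ Ω ↔ |x - l| < ε)) :
    spectralProjection A Ω = cfc (resolventCutoff z l ε) R := by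
  have hc := (continuousOn_resolventCutoff z l hε).mono
    (hgap.trans (compl_resolventAnnulus_subset z l ε))
  have he : (_root_.spectrum ℂ R).EqOn ((resolventPreimage z Ω).indicator 1)
      (resolventCutoff z l ε) := by
    intro w hw
    have hiff : w ∈ resolventPreimage z Ω ↔ ‖1 + (z - l) * w‖ < ε * ‖w‖ := by
      by_cases hw0 : w = 0
      · subst hw0
        simp [resolventPreimage]
      · obtain ⟨x, hx, hxw⟩ := h.exists_ofReal_mem_spectrum hA hw hw0
        rw [norm_one_add_sub_mul z l hw0, mul_lt_mul_iff_left₀ (norm_pos_iff.2 hw0), hxw,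
          ← Complex.ofReal_sub, Complex.norm_real, Real.norm_eq_abs, ← hΩε x hx]
        simp [resolventPreimage, hw0, hxw, -Complex.add_re]
    classical
    simp only [resolventCutoff, Set.indicator_apply, hiff, Set.mem_ofPred_eq]
  rw [h.spectralProjection_eq_cfc hA hΩ (hc.congr he)]
  exact cfc_congr he

end Gap

/-! ### Norm convergence of the transported cutoffs -/

section Convergence

theorem _root_.StarAlgEquiv.isStarNormal_map {A B : Type*} [CStarAlgebra A] [CStarAlgebra B]
    (φ : A ≃⋆ₐ[ℂ] B) {a : A} (ha : IsStarNormal a) : IsStarNormal (φ a) :=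
  ha.map φ

theorem _root_.StarAlgEquiv.map_cfc_of_isStarNormal {A B : Type*} [CStarAlgebra A] [CStarAlgebra B]
    (φ : A ≃⋆ₐ[ℂ] B) (hφ : Continuous φ) {a : A} (ha : IsStarNormal a) {f : ℂ → ℂ}
    (hf : ContinuousOn f (_root_.spectrum ℂ a)) : φ (cfc f a) = cfc f (φ a) :=
  StarAlgHomClass.map_cfc (S := ℂ) φ f a hf hφ ha (φ.isStarNormal_map ha)

variable {H : Type*} [NormedAddCommGroup H] [InnerProductSpace ℂ H] [CompleteSpace H]

open ContinuousLinearMap in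
/-- Norm convergence of the spectral cutoffs of `R n` near `l`, transported by `J n`. -/
theorem tendsto_inverse_comp_cfc_resolventCutoff
    {K : ℕ → Type*} [∀ n, NormedAddCommGroup (K n)] [∀ n, InnerProductSpace ℂ (K n)]
    [∀ n, CompleteSpace (K n)] {J : ∀ n, H →L[ℂ] K n} (hJ : ∀ᶠ n in atTop, (J n).IsInvertible)
    (hG : Tendsto (fun n => (adjoint (J n)).comp (J n)) atTop (𝓝 1))
    {R : ∀ n, K n →L[ℂ] K n} {R₀ : H →L[ℂ] H} (hn : ∀ n, IsStarNormal (R n))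
    (hn₀ : IsStarNormal R₀)
    (hR : Tendsto (fun n => (adjoint (J n)).comp ((R n).comp (J n))) atTop (𝓝 R₀))
    {z l : ℂ} {ε : ℝ} (hε : 0 < ε)
    (hgap : _root_.spectrum ℂ R₀ ⊆ (resolventAnnulus z l ε)ᶜ) :
    (∀ᶠ n in atTop, _root_.spectrum ℂ (R n) ⊆ (resolventAnnulus z l ε)ᶜ) ∧
    Tendsto (fun n => (J n).inverse.comp ((cfc (resolventCutoff z l ε) (R n)).comp (J n))) atTop
      (𝓝 (cfc (resolventCutoff z l ε) R₀)) := by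
  set G : ℕ → H →L[ℂ] H := fun n => (adjoint (J n)).comp (J n) with hGdef
  have hGsa : ∀ n, IsSelfAdjoint (G n) := fun n => by
    rw [hGdef, isSelfAdjoint_iff', adjoint_comp, adjoint_adjoint]
  -- `E = G^{-1/2}` and `D = G^{1/2}`, both tending to `1`; `J E` will be the unitary part of `J`.
  set E : ℕ → H →L[ℂ] H := fun n => cfc (fun x : ℝ => (Real.sqrt x)⁻¹) (G n)
  set D : ℕ → H →L[ℂ] H := fun n => cfc Real.sqrt (G n)
  have hsc : ContinuousOn (fun x : ℝ => (Real.sqrt x)⁻¹) (Set.Icc (1 / 2) (3 / 2)) :=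
    Real.continuous_sqrt.continuousOn.inv₀ fun x hx =>
      (Real.sqrt_pos.2 (lt_of_lt_of_le (by norm_num) hx.1)).ne'
  have hE : Tendsto E atTop (𝓝 1) := tendsto_cfc_of_tendsto_one hG hGsa hsc (by simp)
  have hD : Tendsto D atTop (𝓝 1) :=
    tendsto_cfc_of_tendsto_one hG hGsa Real.continuous_sqrt.continuousOn (by simp)
  have hspec : ∀ᶠ n in atTop, _root_.spectrum ℝ (G n) ⊆ Set.Icc (1 / 2) (3 / 2) :=
    eventually_spectrum_real_subset hG
  have hS : Tendsto (fun n => E n * ((adjoint (J n)).comp ((R n).comp (J n))) * E n) atTop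
      (𝓝 R₀) := by
    simpa using (hE.mul hR).mul hE
  have key : ∀ᶠ n in atTop, ∃ φ : (K n →L[ℂ] K n) ≃⋆ₐ[ℂ] (H →L[ℂ] H), Continuous φ ∧
      ∀ T : K n →L[ℂ] K n, φ T = E n * ((adjoint (J n)).comp (T.comp (J n))) * E n ∧
        (J n).inverse.comp (T.comp (J n)) = E n * φ T * D n := by
    filter_upwards [hJ, hspec] with n hJn hsn
    have hpos : ∀ x ∈ _root_.spectrum ℝ (G n), Real.sqrt x ≠ 0 := fun x hx =>
      (Real.sqrt_pos.2 (lt_of_lt_of_le (by norm_num) (hsn hx).1)).ne'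
    have hc := hsc.mono hsn
    have hsa := hGsa n
    refine exists_starAlgEquiv_of_isInvertible hJn (cfc_predicate _ _) ?_ ?_
    · rw [← cfc_mul _ _ (G n) hc Real.continuous_sqrt.continuousOn, ← cfc_one ℝ (G n)]
      exact cfc_congr fun x hx => inv_mul_cancel₀ (hpos x hx)
    · change E n * G n * E n = 1
      conv_lhs => enter [1, 2]; rw [← cfc_id' ℝ (G n)]
      have hid : ContinuousOn (fun x : ℝ => x) (_root_.spectrum ℝ (G n)) := continuousOn_id
      have hm : ContinuousOn (fun x : ℝ => (Real.sqrt x)⁻¹ * x) (_root_.spectrum ℝ (G n)) :=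
        hc.mul hid
      rw [← cfc_mul _ _ (G n) hc hid, ← cfc_mul _ _ (G n) hm hc, ← cfc_one ℝ (G n)]
      refine cfc_congr fun x hx => ?_
      have h1 := hpos x hx
      have h2 : Real.sqrt x * Real.sqrt x = x :=
        Real.mul_self_sqrt (le_trans (by norm_num) (hsn hx).1)
      change (Real.sqrt x)⁻¹ * x * (Real.sqrt x)⁻¹ = 1
      field_simp
      rw [pow_two, h2]
  have hSn : ∀ᶠ n in atTop,
      IsStarNormal (E n * ((adjoint (J n)).comp ((R n).comp (J n))) * E n) := by
    filter_upwards [key] with n ⟨φ, _, hφ⟩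
    rw [← (hφ (R n)).1]
    exact φ.isStarNormal_map (hn n)
  constructor
  · filter_upwards [key, eventually_spectrum_subset hS
      (isClosed_resolventAnnulus z l ε).isOpen_compl hgap] with n ⟨φ, _, hφ⟩ hs
    -- The isomorphism `φ` preserves spectra, so the gap passes from the transported operator on `H`
    -- back to `R n`.
    rwa [← (hφ (R n)).1, AlgEquiv.spectrum_eq φ] at hs
  · have hf := tendsto_cfc_resolventCutoff hS hSn hn₀ hε hgap
    have hQ := (hE.mul hf).mul hD
    rw [one_mul, mul_one] at hQ
    refine hQ.congr' ?_
    filter_upwards [key, eventually_spectrum_subset hS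
      (isClosed_resolventAnnulus z l ε).isOpen_compl hgap] with n ⟨φ, hφc, hφ⟩ hs
    rw [← (hφ (R n)).1, AlgEquiv.spectrum_eq φ] at hs
    have hc := (continuousOn_resolventCutoff z l hε).mono
      (hs.trans (compl_resolventAnnulus_subset z l ε))
    rw [(hφ _).2, ← (hφ (R n)).1]
    rw [φ.map_cfc_of_isStarNormal hφc (hn n) hc]

end Convergence

end UnboundedOp

/-! ### The main theorem -/

theorem mainTheorem8
    {H : Type*} [NormedAddCommGroup H] [InnerProductSpace ℂ H] [CompleteSpace H]
    [TopologicalSpace.SeparableSpace H]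
    {K : ℕ → Type*} [∀ n, NormedAddCommGroup (K n)] [∀ n, InnerProductSpace ℂ (K n)]
    [∀ n, CompleteSpace (K n)] [∀ n, TopologicalSpace.SeparableSpace (K n)]
    (J : ∀ n, H →L[ℂ] K n) (An : ∀ n, K n →ₗ.[ℂ] K n) (A : H →ₗ.[ℂ] H)
    (hA : IsSelfAdjoint A) (hAn : ∀ n, IsSelfAdjoint (An n))
    (hconv : UnboundedOp.GenNormResolventConverges J An A)
    (l : ℝ) (hl : (l : ℂ) ∈ UnboundedOp.spectrum A)
    (hiso : ¬ AccPt (l : ℂ) (𝓟 (UnboundedOp.spectrum A)))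
    (ε : ℝ) (hε : 0 < ε)
    (hgap : {x : ℝ | (x : ℂ) ∈ UnboundedOp.spectrum A} ∩ Set.Icc (l - ε) (l + ε) = {l}) :
    (∀ᶠ n in atTop, (J n).IsInvertible) ∧
    Tendsto
      (fun n => (J n).inverse.comp
        ((UnboundedOp.spectralProjection (An n) (Set.Ioo (l - ε) (l + ε))).comp (J n)))
      atTop (𝓝 (UnboundedOp.spectralProjection A {l})) ∧
    ∀ᶠ n in atTop,
      UnboundedOp.dimRange ((J n).inverse.comp
          ((UnboundedOp.spectralProjection (An n) (Set.Ioo (l - ε) (l + ε))).comp (J n))) =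
        UnboundedOp.dimRange (UnboundedOp.spectralProjection A {l}) ∧
      UnboundedOp.dimRange (UnboundedOp.spectralProjection (An n) (Set.Ioo (l - ε) (l + ε))) =
        UnboundedOp.dimRange (UnboundedOp.spectralProjection A {l}) := by
  obtain ⟨z, hz, hlim⟩ := hconv.resolvent_tendsto
  have hzA : z ∉ UnboundedOp.spectrum A := fun h => hz (subset_closure (Or.inl h))
  have hzAn : ∀ n, z ∉ UnboundedOp.spectrum (An n) := fun n h =>
    hz (subset_closure (Or.inr (Set.mem_iUnion.2 ⟨n, h⟩)))
  have hR := UnboundedOp.isResolventAt_resolvent hzA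
  have hRn := fun n => UnboundedOp.isResolventAt_resolvent (hzAn n)
  have hG : Tendsto (fun n => (ContinuousLinearMap.adjoint (J n)).comp (J n)) atTop (𝓝 1) :=
    tendsto_iff_norm_sub_tendsto_zero.2 hconv.adjoint_comp
  have hJ : ∀ᶠ n in atTop, (J n).IsInvertible := by
    filter_upwards [hconv.adjoint_comp.eventually_lt_const one_pos,
      hconv.comp_adjoint.eventually_lt_const one_pos] with n h1 h2
    exact ContinuousLinearMap.isInvertible_of_norm_adjoint_comp_sub_lt h1 h2
  have hgapR := hR.spectrum_subset_compl_resolventAnnulus hA hε hgap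
  obtain ⟨hs, hQ⟩ := UnboundedOp.tendsto_inverse_comp_cfc_resolventCutoff hJ hG
    (fun n => (hRn n).isStarNormal (hAn n)) (hR.isStarNormal hA)
    (tendsto_iff_norm_sub_tendsto_zero.2 hlim) hε hgapR
  have hP : UnboundedOp.spectralProjection A {l} = cfc (resolventCutoff z l ε)
      (UnboundedOp.resolvent A z) := by
    -- Within `σ(A)`, the point set `{l}` and the interval `|x - l| < ε` coincide by the gap
    -- hypothesis.
    refine hR.spectralProjection_eq_cfc_resolventCutoff hA hε hgapR (measurableSet_singleton l)
      fun x hx => ⟨fun h => ?_, fun h => ?_⟩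
    · rw [Set.mem_singleton_iff.1 h, sub_self, abs_zero]
      exact hε
    · have h' := abs_lt.1 h
      exact hgap ▸ ⟨hx, by constructor <;> linarith⟩
  have hPn : ∀ᶠ n in atTop, UnboundedOp.spectralProjection (An n) (Set.Ioo (l - ε) (l + ε)) =
      cfc (resolventCutoff z l ε) (UnboundedOp.resolvent (An n) z) := by
    filter_upwards [hs] with n hsn
    refine (hRn n).spectralProjection_eq_cfc_resolventCutoff (hAn n) hε hsn measurableSet_Ioo
      fun x _ => ?_
    rw [Set.mem_Ioo, abs_lt]
    constructor <;> rintro ⟨h1, h2⟩ <;> constructor <;> linarith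
  have hT : Tendsto
      (fun n => (J n).inverse.comp
        ((UnboundedOp.spectralProjection (An n) (Set.Ioo (l - ε) (l + ε))).comp (J n)))
      atTop (𝓝 (UnboundedOp.spectralProjection A {l})) := by
    rw [hP]
    refine hQ.congr' ?_
    filter_upwards [hPn] with n hn
    rw [hn]
  refine ⟨hJ, hT, ?_⟩
  filter_upwards [hJ, hs, hPn, (tendsto_iff_norm_sub_tendsto_zero.1 hT).eventually_lt_const one_pos]
    with n hJn hsn hPnn hlt
  have hidP : IsIdempotentElem (UnboundedOp.spectralProjection A {l}) :=
    hP ▸ hR.isIdempotentElem_cfc hA hε hgapR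
  have hidPn : IsIdempotentElem
      (UnboundedOp.spectralProjection (An n) (Set.Ioo (l - ε) (l + ε))) :=
    hPnn ▸ (hRn n).isIdempotentElem_cfc (hAn n) hε hsn
  -- Conjugation by `J n` preserves idempotents, though not self-adjointness; the dimension
  -- comparison uses idempotency alone.
  have hidQ : IsIdempotentElem ((J n).inverse.comp
      ((UnboundedOp.spectralProjection (An n) (Set.Ioo (l - ε) (l + ε))).comp (J n))) := by
    ext x
    have h1 : ∀ y, J n ((J n).inverse y) = y := fun y =>
      congrArg (fun B : K n →L[ℂ] K n => B y) hJn.self_comp_inverse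
    change (J n).inverse (UnboundedOp.spectralProjection (An n) _ (J n ((J n).inverse
      (UnboundedOp.spectralProjection (An n) _ (J n x))))) = _
    rw [h1]
    exact congrArg (fun B : K n →L[ℂ] K n => (J n).inverse (B (J n x))) hidPn
  have h1 := UnboundedOp.dimRange_eq_of_norm_sub_lt_one hidQ hidP hlt
  exact ⟨h1, (UnboundedOp.dimRange_inverse_comp hJn _).symm.trans h1⟩
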